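/- Let $N\ge 0$ be an integer and let $a,b,\beta$ be real numbers with $a>-1$, $b>0$, $\beta\ge 0$. For $p=0,1,\dots,N$ and $x\in\mathbb C$ define $$ \hat H_p(x)=\frac{1}{\binom Np}\int_0^1dt_1\cdots\int_0^1dt_N\,\prod_{l=1}^N t_l^{a}(1-t_l)^{b-1}\,e^{-x\sum_{l=1}^N t_l}\prod_{1\le j<k\le N}|t_k-t_j|^{\beta}\;e_p(1-t_1,\dots,1-t_N), $$ where $e_p$ is the $p$-th elementary symmetric polynomial, and put $$ \tilde B_p=p\Big(a+b+1+\tfrac{\beta}{2}(2N-p-1)\Big),\qquad \tilde D_p=p\Big(\tfrac{\beta}{2}(N-p)+b\Big). $$ Then these integrals converge absolutely, each $\hat H_p$ is an entire function of $x$, and for all $x\in\mathbb C$ and $p=0,1,\dots,N$ $$ (N-p)\,x\,\hat H_{p+1}(x)=\Big((N-p)x+\tilde B_p\Big)\hat H_p(x)+x\frac{d}{dx}\hat H_p(x)-\tilde D_p\,\hat H_{p-1}(x), $$ where for $p=N$ the left side is $0$ and for $p=0$ the last term is $0$ (its coefficient $\tilde D_0$ vanishes). Moreover, let $\mathbf X,\mathbf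 Y$ be the $(N+1)\times(N+1)$ matrices, with rows and columns numbered $0,\dots,N$, whose only nonzero entries are among $$ \mathbf X_{p,p}=-(N-p)\ (0\le p\le N),\quad \mathbf X_{p,p+1}=N-p\ (0\le p<N),\qquad \mathbf Y_{p,p}=-\tilde B_p\ (0\le p\le N),\quad \mathbf Y_{p,p-1}=\tilde D_p\ (1\le p\le N). $$ Then $\hat{\mathbf H}(x)=[\hat H_p(x)]_{p=0}^N$ satisfies, for all $x\in\mathbb C$, $$ x\frac{d}{dx}\hat{\mathbf H}(x)=(x\mathbf X+\mathbf Y)\,\hat{\mathbf H}(x), $$ and for any functions $G_0,\dots,G_N$ that are complex differentiable at a point $x\in\mathbb C$, the $N+1$ equations of the differential-difference system with $G_p$ in place of $\hat H_p$ hold at $x$ if and only if the matrix equation with $\mathbf G=[G_p]_{p=0}^N$ in place of $\hat{\mathbf H}$ holds at $x$. -/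

import Mathlib

open MeasureTheory

noncomputable section

namespace JacobiTrace

/-- The integrand of the Laplace-type integral: the `β`-Jacobi weight with exponents `a` and `b - 1`,
times `e_p(1 - t_1, …, 1 - t_N)`, times `exp (-x (t_1 + ⋯ + t_N))`. -/
def integrand (N : ℕ) (a b β : ℝ) (p : ℕ) (x : ℂ) (t : Fin N → ℝ) : ℂ :=
  (((∏ l, (t l) ^ a * (1 - t l) ^ (b - 1)) *
      (∏ j : Fin N, ∏ k ∈ Finset.Ioi j, |t k - t j| ^ β) *
      MvPolynomial.eval (fun l => 1 - t l) (MvPolynomial.esymm (Fin N) ℝ p) : ℝ) : ℂ) *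
    Complex.exp (-x * ∑ l, (t l : ℂ))

/-- The open unit cube `(0, 1) ^ N`. -/
def cube (N : ℕ) : Set (Fin N → ℝ) := Set.univ.pi fun _ => Set.Ioo (0 : ℝ) 1

/-- The functions `Ĥ_p(x)`. They are meant for `0 ≤ p ≤ N`. -/
def Hhat (N : ℕ) (a b β : ℝ) (p : ℕ) (x : ℂ) : ℂ :=
  1 / (N.choose p : ℂ) * ∫ t in cube N, integrand N a b β p x t

/-- `B̃_p = p (a + b + 1 + (β / 2) (2 N - p - 1))`. -/
def Btilde (N : ℕ) (a b β : ℝ) (p : ℕ) : ℝ :=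
  p * (a + b + 1 + β / 2 * (2 * N - p - 1))

/-- `D̃_p = p ((β / 2) (N - p) + b)`. -/
def Dtilde (N : ℕ) (b β : ℝ) (p : ℕ) : ℝ :=
  p * (β / 2 * (N - p) + b)

/-- The equations, for `p = 0, …, N`, of the differential-difference system at the point `x`, for a
family `G` of functions. The members `G (N + 1)` and `G (-1)` do not matter: for `p = N` the factor
`N - p` vanishes, and for `p = 0` (where `p - 1` is read as `0`) the factor `D̃_p` vanishes. -/
def SystemAt (N : ℕ) (a b β : ℝ) (G : ℕ → ℂ → ℂ) (x : ℂ) : Prop :=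
  ∀ p : ℕ, p ≤ N →
    ((N : ℂ) - p) * x * G (p + 1) x =
      (((N : ℂ) - p) * x + (Btilde N a b β p : ℂ)) * G p x + x * deriv (G p) x
        - (Dtilde N b β p : ℂ) * G (p - 1) x

/-- `X = - diag [N, N - 1, …, 0] + diag⁺ [N, N - 1, …, 1]`. -/
def X (N : ℕ) : Matrix (Fin (N + 1)) (Fin (N + 1)) ℂ :=
  Matrix.of fun i j =>
    if (j : ℕ) = i then -((N : ℂ) - (i : ℕ))
    else if (j : ℕ) = i + 1 then (N : ℂ) - (i : ℕ)
    else 0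

/-- `Y = - diag [B̃_0, …, B̃_N] + diag⁻ [D̃_1, …, D̃_N]`. -/
def Y (N : ℕ) (a b β : ℝ) : Matrix (Fin (N + 1)) (Fin (N + 1)) ℂ :=
  Matrix.of fun i j =>
    if (j : ℕ) = i then -(Btilde N a b β i : ℂ)
    else if (i : ℕ) = j + 1 then (Dtilde N b β i : ℂ)
    else 0

/-- The column vector `[G_p(x)]_{p = 0}^N` of a family of functions. -/
def vec (N : ℕ) (G : ℕ → ℂ → ℂ) (x : ℂ) : Fin (N + 1) → ℂ := fun p => G p x

/-- The matrix differential equation `x (d/dx) G(x) = (x X + Y) G(x)` at the point `x`. -/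
def MatrixEqAt (N : ℕ) (a b β : ℝ) (G : ℕ → ℂ → ℂ) (x : ℂ) : Prop :=
  x • deriv (vec N G) x = (x • X N + Y N a b β).mulVec (vec N G x)

end JacobiTrace

end

/-! For p = q + 1 the equation is an integrated divergence. With w the weight, take the vector field
whose l-th component is t_l (1 - t_l) w(t) e_q(1 - t_j : j ≠ l) exp(-x ∑ t_j). Since a + 1 > 0 and b
> 0, this component vanishes at t_l = 0 and t_l = 1, so its t_l-derivative integrates to zero over
the cube (`integral_divTerm`). Summed over l, the derivatives become a pointwise combination of the
integrands for q, q + 1, q + 2 and the x-derivative of the one for q + 1 (`sum_divTerm`). The poles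
of β t_l (1 - t_l) / (t_l - t_k) cancel in this sum when l and k are exchanged
(`sum_esymmOn_div_sub`). The case p = 0 needs no integration by parts: N - ∑ t_l = e_1(1 - t).

The analytic difficulty lies at the collisions t_l = t_k, where a single derivative may be
unbounded. For β > 0 it is controlled by |t_l - t_k| ^ (β - 1), which is integrable
(`integrableOn_weight_div_sub`); for β = 0 the singular terms are absent. On a line parallel to an
axis the moving coordinate meets only finitely many others, and the primitive stays continuous
there, so the fundamental theorem of calculus still applies (`integral_divTerm_insertNth`).

The matrix equation is the same system with each equation solved for x G_p'. -/

namespace JacobiTrace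

/-! ### Elementary symmetric polynomial identities -/

/-- The elementary symmetric polynomial of degree `q` in the variables `s i`, `i ∈ A`. -/
def esymmOn {ι : Type*} (A : Finset ι) (q : ℕ) (s : ι → ℝ) : ℝ :=
  ∑ B ∈ A.powersetCard q, ∏ i ∈ B, s i

section esymmOn

variable {ι : Type*} (s : ι → ℝ)

@[simp] lemma esymmOn_zero (A : Finset ι) : esymmOn A 0 s = 1 := by
  simp [esymmOn]

@[simp] lemma esymmOn_empty_succ (q : ℕ) : esymmOn (∅ : Finset ι) (q + 1) s = 0 := by
  rw [esymmOn, Finset.powersetCard_eq_empty.2 (by simp), Finset.sum_empty]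

variable [DecidableEq ι]

lemma esymmOn_insert_succ {A : Finset ι} {i : ι} (hi : i ∉ A) (q : ℕ) :
    esymmOn (insert i A) (q + 1) s = esymmOn A (q + 1) s + s i * esymmOn A q s := by
  have hB : ∀ {B : Finset ι}, B ∈ A.powersetCard q → i ∉ B := fun hB h =>
    hi ((Finset.mem_powersetCard.1 hB).1 h)
  unfold esymmOn
  rw [Finset.powersetCard_succ_insert hi, Finset.sum_union, Finset.sum_image, Finset.mul_sum]
  · congr 1
    exact Finset.sum_congr rfl fun B h => Finset.prod_insert (hB h)
  · intro B h C h' e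
    rw [← Finset.erase_insert (hB h), ← Finset.erase_insert (hB h'), e]
  · rw [Finset.disjoint_left]
    intro B h h'
    obtain ⟨C, -, rfl⟩ := Finset.mem_image.1 h'
    exact hi ((Finset.mem_powersetCard.1 h).1 (Finset.mem_insert_self i C))

lemma esymmOn_succ {A : Finset ι} {i : ι} (hi : i ∈ A) (q : ℕ) :
    esymmOn A (q + 1) s = esymmOn (A.erase i) (q + 1) s + s i * esymmOn (A.erase i) q s := by
  rw [← esymmOn_insert_succ s (Finset.notMem_erase i A), Finset.insert_erase hi]

lemma sum_mul_esymmOn_erase (A : Finset ι) (q : ℕ) :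
    ∑ l ∈ A, s l * esymmOn (A.erase l) q s = (q + 1) * esymmOn A (q + 1) s := by
  induction A using Finset.induction_on generalizing q with
  | empty => simp
  | insert i A hi ih =>
    have h1 : ∀ l ∈ A, (insert i A).erase l = insert i (A.erase l) := fun l hl =>
      Finset.erase_insert_of_ne fun h => hi (h ▸ hl)
    have h2 : ∀ l, i ∉ A.erase l := fun l h => hi (Finset.mem_of_mem_erase h)
    rw [Finset.sum_insert hi, Finset.erase_insert hi, esymmOn_insert_succ s hi]
    cases q with
    | zero =>
      have := ih 0
      simp only [esymmOn_zero, Nat.cast_zero] at this ⊢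
      linarith
    | succ q =>
      have h3 : ∑ l ∈ A, s l * esymmOn ((insert i A).erase l) (q + 1) s =
          ∑ l ∈ A, s l * esymmOn (A.erase l) (q + 1) s +
            s i * ∑ l ∈ A, s l * esymmOn (A.erase l) q s := by
        rw [Finset.mul_sum, ← Finset.sum_add_distrib]
        refine Finset.sum_congr rfl fun l hl => ?_
        rw [h1 l hl, esymmOn_insert_succ s (h2 l)]
        ring
      rw [h3, ih, ih]
      push_cast
      ring

lemma sum_esymmOn_erase (A : Finset ι) (q : ℕ) :
    ∑ l ∈ A, esymmOn (A.erase l) q s = (A.card - q) * esymmOn A q s := by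
  cases q with
  | zero => simp
  | succ q =>
    have h : ∑ l ∈ A, esymmOn (A.erase l) (q + 1) s =
        ∑ l ∈ A, (esymmOn A (q + 1) s - s l * esymmOn (A.erase l) q s) :=
      Finset.sum_congr rfl fun l hl => by rw [esymmOn_succ s hl]; ring
    rw [h, Finset.sum_sub_distrib, sum_mul_esymmOn_erase, Finset.sum_const, nsmul_eq_mul]
    push_cast
    ring

lemma sum_mul_esymmOn (A : Finset ι) (q : ℕ) :
    (∑ l ∈ A, s l) * esymmOn A (q + 1) s =
      (q + 2) * esymmOn A (q + 2) s + ∑ l ∈ A, s l ^ 2 * esymmOn (A.erase l) q s := by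
  have h := sum_mul_esymmOn_erase s A (q + 1)
  push_cast at h
  rw [show (q : ℝ) + 2 = q + 1 + 1 by ring, ← h, ← Finset.sum_add_distrib, Finset.sum_mul]
  refine Finset.sum_congr rfl fun l hl => ?_
  rw [esymmOn_succ s hl]
  ring

lemma esymmOn_one (A : Finset ι) : esymmOn A 1 s = ∑ l ∈ A, s l := by
  have := sum_mul_esymmOn_erase s A 0
  simp only [esymmOn_zero, mul_one, Nat.cast_zero, zero_add, one_mul] at this
  exact this.symm

/-- With E and C the polynomials of degrees q and q - 1 without both variables, the two factors are
E + s_k C and E + s_l C. The combined numerator is then divisible by s_k - s_l, so the pole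
disappears. -/
lemma esymmOn_pair {A : Finset ι} {l k : ι} (hl : l ∈ A) (hk : k ∈ A) (hlk : s l ≠ s k) (q : ℕ) :
    s l * (1 - s l) * esymmOn (A.erase l) q s / (s k - s l) +
      s k * (1 - s k) * esymmOn (A.erase k) q s / (s l - s k) =
    -esymmOn ((A.erase l).erase k) q s + s k * esymmOn ((A.erase l).erase k) q s +
      s l * esymmOn (A.erase l) q s := by
  have hne : l ≠ k := fun h => hlk (h ▸ rfl)
  obtain ⟨C, h1, h2⟩ : ∃ C, esymmOn (A.erase l) q s = esymmOn ((A.erase l).erase k) q s + s k * C ∧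
      esymmOn (A.erase k) q s = esymmOn ((A.erase l).erase k) q s + s l * C := by
    cases q with
    -- Here C would have degree -1, hence is zero.
    | zero => exact ⟨0, by simp⟩
    | succ q =>
      refine ⟨esymmOn ((A.erase l).erase k) q s, esymmOn_succ s (by simp [hk, hne.symm]) q, ?_⟩
      rw [Finset.erase_right_comm]
      exact esymmOn_succ s (by simp [hl, hne]) q
  rw [h1, h2]
  have h3 : s k - s l ≠ 0 := sub_ne_zero.2 hlk.symm
  have h4 : s l - s k ≠ 0 := sub_ne_zero.2 hlk
  rw [div_add_div _ _ h3 h4, div_eq_iff (mul_ne_zero h3 h4)]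
  ring

lemma sum_sum_erase_comm (A : Finset ι) (f : ι → ι → ℝ) :
    ∑ l ∈ A, ∑ k ∈ A.erase l, f l k = ∑ l ∈ A, ∑ k ∈ A.erase l, f k l := by
  refine Finset.sum_comm' fun l k => ?_
  simp only [Finset.mem_erase]
  tauto

lemma sum_esymmOn_div_sub (A : Finset ι) (hs : Set.InjOn s A) (q : ℕ) :
    2 * ∑ l ∈ A, ∑ k ∈ A.erase l, s l * (1 - s l) * esymmOn (A.erase l) q s / (s k - s l) =
      (q + 1) * (2 * A.card - q - 2) * esymmOn A (q + 1) s
        - (A.card - q - 1) * (A.card - q) * esymmOn A q s := by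
  have hcard : ∀ l ∈ A, (((A.erase l).card : ℕ) : ℝ) = A.card - 1 := fun l hl => by
    rw [← Finset.card_erase_add_one hl]; push_cast; ring
  rw [two_mul]
  -- Exchanging l and k in one of the two copies pairs each term with its mirror image.
  nth_rewrite 2 [sum_sum_erase_comm]
  rw [← Finset.sum_add_distrib]
  have h : ∀ l ∈ A, ∑ k ∈ A.erase l, s l * (1 - s l) * esymmOn (A.erase l) q s / (s k - s l) +
      ∑ k ∈ A.erase l, s k * (1 - s k) * esymmOn (A.erase k) q s / (s l - s k) =
      -((A.card - q - 1) * esymmOn (A.erase l) q s) + (q + 1) * esymmOn (A.erase l) (q + 1) s +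
        (A.card - 1) * (s l * esymmOn (A.erase l) q s) := by
    intro l hl
    rw [← Finset.sum_add_distrib]
    have h' : ∀ k ∈ A.erase l, s l * (1 - s l) * esymmOn (A.erase l) q s / (s k - s l) +
        s k * (1 - s k) * esymmOn (A.erase k) q s / (s l - s k) =
        -esymmOn ((A.erase l).erase k) q s + s k * esymmOn ((A.erase l).erase k) q s +
          s l * esymmOn (A.erase l) q s := fun k hk =>
      esymmOn_pair s hl (Finset.mem_of_mem_erase hk) (fun e => Finset.ne_of_mem_erase hk
        (hs hl (Finset.mem_of_mem_erase hk) e).symm) q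
    rw [Finset.sum_congr rfl h', Finset.sum_add_distrib, Finset.sum_add_distrib,
      Finset.sum_neg_distrib, sum_esymmOn_erase, sum_mul_esymmOn_erase, Finset.sum_const,
      nsmul_eq_mul, hcard l hl]
    ring
  rw [Finset.sum_congr rfl h, Finset.sum_add_distrib, Finset.sum_add_distrib,
    Finset.sum_neg_distrib, ← Finset.mul_sum, ← Finset.mul_sum, ← Finset.mul_sum,
    sum_mul_esymmOn_erase, sum_esymmOn_erase, sum_esymmOn_erase]
  push_cast
  ring

end esymmOn

/-! ### The weight: bounds and integrability -/

/-- The one-variable Jacobi weight on `(0, 1)`. -/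
noncomputable def betaWeight (a b u : ℝ) : ℝ := u ^ a * (1 - u) ^ (b - 1)

/-- The interaction factor `∏_{j < k} |t_k - t_j| ^ β`. -/
noncomputable def repulsion {N : ℕ} (β : ℝ) (t : Fin N → ℝ) : ℝ :=
  ∏ j : Fin N, ∏ k ∈ Finset.Ioi j, |t k - t j| ^ β

/-- The `β`-Jacobi weight. -/
noncomputable def weight {N : ℕ} (a b β : ℝ) (t : Fin N → ℝ) : ℝ :=
  (∏ l, betaWeight a b (t l)) * repulsion β t

lemma integrand_eq (N : ℕ) (a b β : ℝ) (p : ℕ) (x : ℂ) (t : Fin N → ℝ) :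
    integrand N a b β p x t =
      ((weight a b β t * esymmOn Finset.univ p (fun l => 1 - t l) : ℝ) : ℂ) *
        Complex.exp (-x * ∑ l, (t l : ℂ)) := by
  simp [integrand, weight, betaWeight, repulsion, esymmOn, MvPolynomial.esymm, map_sum, map_prod]

lemma measurableSet_cube (N : ℕ) : MeasurableSet (cube N) :=
  MeasurableSet.univ_pi fun _ => measurableSet_Ioo

lemma mem_cube {N : ℕ} {t : Fin N → ℝ} : t ∈ cube N ↔ ∀ l, t l ∈ Set.Ioo (0 : ℝ) 1 := by
  simp [cube]

lemma volume_restrict_cube (N : ℕ) :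
    (volume : Measure (Fin N → ℝ)).restrict (cube N) =
      Measure.pi fun _ : Fin N => (volume : Measure ℝ).restrict (Set.Ioo 0 1) := by
  rw [volume_pi, cube, Measure.restrict_pi_pi]

lemma betaWeight_nonneg (a b : ℝ) {u : ℝ} (hu : u ∈ Set.Ioo (0 : ℝ) 1) : 0 ≤ betaWeight a b u :=
  mul_nonneg (Real.rpow_nonneg hu.1.le _) (Real.rpow_nonneg (sub_nonneg.2 hu.2.le) _)

@[fun_prop]
lemma measurable_betaWeight (a b : ℝ) : Measurable (betaWeight a b) := by
  unfold betaWeight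
  fun_prop

lemma integrableOn_betaWeight {a b : ℝ} (ha : -1 < a) (hb : 0 < b) :
    Integrable (betaWeight a b) ((volume : Measure ℝ).restrict (Set.Ioo 0 1)) := by
  have h := Complex.betaIntegral_convergent (u := (a + 1 : ℝ)) (v := (b : ℝ))
    (by simpa using by linarith) (by simpa using hb)
  rw [intervalIntegrable_iff_integrableOn_Ioo_of_le zero_le_one] at h
  refine (integrable_congr ?_).1 h.norm
  refine ae_restrict_of_forall_mem measurableSet_Ioo fun u hu => ?_
  have h1 : (0 : ℝ) < 1 - u := sub_pos.2 hu.2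
  have h2 : (1 - (u : ℂ)) = ((1 - u : ℝ) : ℂ) := by push_cast; rfl
  simp only [norm_mul, h2]
  rw [Complex.norm_cpow_eq_rpow_re_of_pos hu.1, Complex.norm_cpow_eq_rpow_re_of_pos h1]
  simp [betaWeight]

/-- The extra factor raises the exponents to a + 1 and b, both positive. This frees the l-th
variable from its endpoint singularities, leaving only the collision singularity to integrate. -/
lemma betaWeight_mul_le_one {a b : ℝ} (ha : -1 < a) (hb : 0 < b) {u : ℝ}
    (hu : u ∈ Set.Ioo (0 : ℝ) 1) : betaWeight a b u * (u * (1 - u)) ≤ 1 := by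
  have h1 : (0 : ℝ) < 1 - u := sub_pos.2 hu.2
  have h : betaWeight a b u * (u * (1 - u)) = u ^ (a + 1) * (1 - u) ^ b := by
    rw [betaWeight, Real.rpow_add_one hu.1.ne', Real.rpow_sub_one h1.ne']
    field_simp
  rw [h]
  exact mul_le_one₀ (Real.rpow_le_one hu.1.le hu.2.le (by linarith)) (Real.rpow_nonneg h1.le _)
    (Real.rpow_le_one h1.le (by linarith [hu.1]) hb.le)

lemma continuous_repulsion {N : ℕ} {β : ℝ} (hβ : 0 ≤ β) :
    Continuous (repulsion β : (Fin N → ℝ) → ℝ) := by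
  unfold repulsion
  refine continuous_finsetProd _ fun j _ => continuous_finsetProd _ fun k _ => ?_
  exact Continuous.rpow_const (by fun_prop) fun _ => Or.inr hβ

lemma repulsion_nonneg {N : ℕ} (β : ℝ) (t : Fin N → ℝ) : 0 ≤ repulsion β t :=
  Finset.prod_nonneg fun _ _ => Finset.prod_nonneg fun _ _ => Real.rpow_nonneg (abs_nonneg _) _

lemma abs_sub_rpow_le_one {N : ℕ} {β : ℝ} (hβ : 0 ≤ β) {t : Fin N → ℝ} (ht : t ∈ cube N)
    (j k : Fin N) : |t k - t j| ^ β ≤ 1 := by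
  have hj := mem_cube.1 ht j
  have hk := mem_cube.1 ht k
  refine Real.rpow_le_one (abs_nonneg _) (abs_le.2 ⟨?_, ?_⟩) hβ <;> linarith [hj.1, hj.2, hk.1, hk.2]

lemma prod_le_of_mem {ι : Type*} {A : Finset ι} {f : ι → ℝ} (h0 : ∀ i ∈ A, 0 ≤ f i)
    (h1 : ∀ i ∈ A, f i ≤ 1) {i : ι} (hi : i ∈ A) : ∏ j ∈ A, f j ≤ f i := by
  classical
  rw [← Finset.mul_prod_erase A f hi]
  exact mul_le_of_le_one_right (h0 i hi) (Finset.prod_le_one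
    (fun j hj => h0 j (Finset.mem_of_mem_erase hj)) fun j hj => h1 j (Finset.mem_of_mem_erase hj))

/-- All other factors are at most 1 on the cube. -/
lemma repulsion_le {N : ℕ} {β : ℝ} (hβ : 0 ≤ β) {t : Fin N → ℝ} (ht : t ∈ cube N)
    {l k : Fin N} (hlk : l ≠ k) : repulsion β t ≤ |t l - t k| ^ β := by
  wlog h : k < l generalizing l k
  · rw [abs_sub_comm]
    exact this hlk.symm (lt_of_le_of_ne (not_lt.1 h) hlk)
  have h0 : ∀ i j : Fin N, 0 ≤ |t j - t i| ^ β := fun i j => Real.rpow_nonneg (abs_nonneg _) _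
  refine (prod_le_of_mem (fun i _ => Finset.prod_nonneg fun j _ => h0 i j)
    (fun i _ => Finset.prod_le_one (fun j _ => h0 i j) fun j _ => abs_sub_rpow_le_one hβ ht i j)
    (Finset.mem_univ k)).trans ?_
  exact prod_le_of_mem (fun j _ => h0 k j) (fun j _ => abs_sub_rpow_le_one hβ ht k j)
    (Finset.mem_Ioi.2 h)

lemma repulsion_le_one {N : ℕ} {β : ℝ} (hβ : 0 ≤ β) {t : Fin N → ℝ} (ht : t ∈ cube N) :
    repulsion β t ≤ 1 :=
  Finset.prod_le_one (fun _ _ => Finset.prod_nonneg fun _ _ => Real.rpow_nonneg (abs_nonneg _) _)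
    fun _ _ => Finset.prod_le_one (fun _ _ => Real.rpow_nonneg (abs_nonneg _) _)
      fun _ _ => abs_sub_rpow_le_one hβ ht _ _

lemma repulsion_eq_zero {N : ℕ} {β : ℝ} (hβ : β ≠ 0) {t : Fin N → ℝ}
    (ht : ¬ Function.Injective t) : repulsion β t = 0 := by
  obtain ⟨j, k, hjk, hlt⟩ : ∃ j k, t j = t k ∧ j < k := by
    simp only [Function.Injective, not_forall] at ht
    obtain ⟨j, k, h, hne⟩ := ht
    rcases lt_or_gt_of_ne hne with h' | h'
    exacts [⟨j, k, h, h'⟩, ⟨k, j, h.symm, h'⟩]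
  refine Finset.prod_eq_zero (Finset.mem_univ j) (Finset.prod_eq_zero (Finset.mem_Ioi.2 hlt) ?_)
  rw [hjk, sub_self, abs_zero, Real.zero_rpow hβ]

lemma measurable_weight {N : ℕ} (a b : ℝ) {β : ℝ} (hβ : 0 ≤ β) :
    Measurable (weight a b β : (Fin N → ℝ) → ℝ) := by
  have := (continuous_repulsion (N := N) hβ).measurable
  unfold weight
  fun_prop

lemma integrable_weight (N : ℕ) {a b β : ℝ} (ha : -1 < a) (hb : 0 < b) (hβ : 0 ≤ β) :
    IntegrableOn (weight a b β : (Fin N → ℝ) → ℝ) (cube N) := by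
  have h : IntegrableOn (fun t : Fin N → ℝ => ∏ l, betaWeight a b (t l)) (cube N) := by
    rw [IntegrableOn, volume_restrict_cube]
    exact Integrable.fintype_prod fun _ => integrableOn_betaWeight ha hb
  refine h.mono' (measurable_weight a b hβ).aestronglyMeasurable ?_
  refine ae_restrict_of_forall_mem (measurableSet_cube N) fun t ht => ?_
  have h0 : 0 ≤ ∏ l, betaWeight a b (t l) :=
    Finset.prod_nonneg fun l _ => betaWeight_nonneg a b (mem_cube.1 ht l)
  rw [weight, Real.norm_of_nonneg (mul_nonneg h0 (repulsion_nonneg β t))]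
  exact mul_le_of_le_one_right h0 (repulsion_le_one hβ ht)

lemma exists_norm_le_on_cube {N : ℕ} {g : (Fin N → ℝ) → ℂ} (hg : Continuous g) :
    ∃ C, ∀ t ∈ cube N, ‖g t‖ ≤ C := by
  obtain ⟨C, hC⟩ := (isCompact_univ_pi fun _ : Fin N =>
    isCompact_Icc (a := (0 : ℝ)) (b := 1)).exists_bound_of_continuousOn hg.continuousOn
  exact ⟨C, fun t ht => hC t fun i hi => Set.Ioo_subset_Icc_self (ht i hi)⟩

lemma IntegrableOn.mul_continuous {N : ℕ} {f g : (Fin N → ℝ) → ℂ} (hf : IntegrableOn f (cube N))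
    (hg : Continuous g) : IntegrableOn (fun t => f t * g t) (cube N) := by
  obtain ⟨C, hC⟩ := exists_norm_le_on_cube hg
  exact Integrable.mul_bdd (c := C) hf hg.aestronglyMeasurable
    (ae_restrict_of_forall_mem (measurableSet_cube N) hC)

@[fun_prop]
lemma continuous_esymmOn {N : ℕ} (A : Finset (Fin N)) (q : ℕ) :
    Continuous fun t : Fin N → ℝ => esymmOn A q (fun l => 1 - t l) := by
  unfold esymmOn
  fun_prop

lemma integrableOn_integrand (N : ℕ) {a b β : ℝ} (ha : -1 < a) (hb : 0 < b) (hβ : 0 ≤ β) (p : ℕ)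
    (x : ℂ) : IntegrableOn (integrand N a b β p x) (cube N) := by
  have h := IntegrableOn.mul_continuous (integrable_weight N ha hb hβ).ofReal
    (g := fun t => ((esymmOn Finset.univ p (fun l => 1 - t l) : ℝ) : ℂ) *
      Complex.exp (-x * ∑ l, (t l : ℂ))) (by fun_prop)
  refine h.congr_fun (fun t _ => ?_) (measurableSet_cube N)
  simp [integrand_eq, mul_assoc]

/-! ### Differentiation under the integral sign -/

lemma hasDerivAt_integral_mul_exp {N : ℕ} {f : (Fin N → ℝ) → ℂ} (hf : IntegrableOn f (cube N))
    (x : ℂ) :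
    HasDerivAt (fun y : ℂ => ∫ t in cube N, f t * Complex.exp (-y * ∑ l, (t l : ℂ)))
      (∫ t in cube N, f t * Complex.exp (-x * ∑ l, (t l : ℂ)) * -∑ l, (t l : ℂ)) x := by
  have hexp : ∀ y : ℂ, IntegrableOn (fun t => f t * Complex.exp (-y * ∑ l, (t l : ℂ))) (cube N) :=
    fun y => IntegrableOn.mul_continuous hf (by fun_prop)
  have hS : ∀ t ∈ cube N, ‖∑ l, (t l : ℂ)‖ ≤ N := fun t ht => by
    refine (norm_sum_le_of_le (f := fun l : Fin N => (t l : ℂ)) (n := fun _ => 1) _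
      fun l _ => ?_).trans (by simp)
    have := mem_cube.1 ht l
    rw [Complex.norm_real, Real.norm_of_nonneg this.1.le]
    exact this.2.le
  refine (hasDerivAt_integral_of_dominated_loc_of_deriv_le (Metric.ball_mem_nhds x one_pos)
    (F' := fun y t => f t * Complex.exp (-y * ∑ l, (t l : ℂ)) * -∑ l, (t l : ℂ))
    (bound := fun t => ‖f t‖ * Real.exp ((‖x‖ + 1) * N) * N)
    (Filter.Eventually.of_forall fun y => (hexp y).aestronglyMeasurable) (hexp x)
    (IntegrableOn.mul_continuous (hexp x)
      (g := fun t => -∑ l, (t l : ℂ)) (by fun_prop)).aestronglyMeasurable ?_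
    ((hf.norm.mul_const _).mul_const _) ?_).2
  · refine ae_restrict_of_forall_mem (measurableSet_cube N) fun t ht y hy => ?_
    rw [norm_mul, norm_mul, norm_neg]
    refine mul_le_mul (mul_le_mul_of_nonneg_left ?_ (norm_nonneg _)) (hS t ht) (norm_nonneg _)
      (by positivity)
    refine (Complex.norm_exp_le_exp_norm _).trans (Real.exp_le_exp.2 ?_)
    rw [norm_mul, norm_neg]
    refine mul_le_mul ?_ (hS t ht) (norm_nonneg _) (by positivity)
    have h1 : ‖y‖ ≤ ‖x‖ + ‖y - x‖ := norm_le_norm_add_norm_sub' y x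
    have h2 : ‖y - x‖ < 1 := by simpa [dist_eq_norm] using hy
    linarith
  · refine Filter.Eventually.of_forall fun t y _ => ?_
    have := (((hasDerivAt_id y).neg.mul_const (∑ l, (t l : ℂ))).cexp.const_mul (f t))
    refine this.congr_deriv ?_
    simp only [Pi.neg_apply, id]
    ring

lemma hasDerivAt_integral_integrand (N : ℕ) {a b β : ℝ} (ha : -1 < a) (hb : 0 < b) (hβ : 0 ≤ β)
    (p : ℕ) (x : ℂ) :
    HasDerivAt (fun y : ℂ => ∫ t in cube N, integrand N a b β p y t)
      (∫ t in cube N, integrand N a b β p x t * -∑ l, (t l : ℂ)) x := by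
  have h : IntegrableOn (fun t : Fin N → ℝ =>
      ((weight a b β t * esymmOn Finset.univ p (fun l => 1 - t l) : ℝ) : ℂ)) (cube N) := by
    refine (IntegrableOn.mul_continuous (integrable_weight N ha hb hβ).ofReal
      (g := fun t => ((esymmOn Finset.univ p (fun l => 1 - t l) : ℝ) : ℂ)) (by fun_prop)).congr_fun
      (fun t _ => ?_) (measurableSet_cube N)
    simp
  simpa only [integrand_eq] using hasDerivAt_integral_mul_exp h x

/-! ### Integrability near collisions -/

/-- Differences of points of (0, 1) lie in (-1, 1), so the power may be cut off there and becomes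
integrable on the whole line. By translation invariance its integral in the first variable no longer
depends on t, and the two variables decouple. -/
lemma integrable_mul_abs_sub_rpow {n : ℕ} {β : ℝ} (hβ : 0 < β) {v : (Fin n → ℝ) → ℝ}
    {μ : Measure (Fin n → ℝ)} [SFinite μ] (hv : Integrable v μ) (k : Fin n)
    (hk : ∀ᵐ t ∂μ, t k ∈ Set.Ioo (0 : ℝ) 1) :
    Integrable (fun z : ℝ × (Fin n → ℝ) => v z.2 * |z.1 - z.2 k| ^ (β - 1))
      (((volume : Measure ℝ).restrict (Set.Ioo 0 1)).prod μ) := by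
  set h : ℝ → ℝ := (Set.Ioo (-1 : ℝ) 1).indicator fun u => |u| ^ (β - 1) with hh
  have hint : Integrable h := by
    rw [hh, integrable_indicator_iff measurableSet_Ioo]
    have h1 : IntegrableOn (fun u : ℝ => |u| ^ (β - 1)) (Set.Ioo 0 1) := by
      refine ((intervalIntegral.integrableOn_Ioo_rpow_iff one_pos).2
        (by linarith : -1 < β - 1)).congr_fun (fun u hu => ?_) measurableSet_Ioo
      simp only [abs_of_pos hu.1]
    have h2 : IntegrableOn (fun u : ℝ => |u| ^ (β - 1)) (Set.Ioo (-1) 0) := by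
      rw [← (Measure.measurePreserving_neg (volume : Measure ℝ)).integrableOn_comp_preimage
        (Homeomorph.neg ℝ).measurableEmbedding] at h1
      simpa [Function.comp_def] using h1
    have h3 : Set.Ioo (-1 : ℝ) 1 ⊆ (Set.Ioo (-1) 0 ∪ {0}) ∪ Set.Ioo 0 1 := by
      intro u hu
      rcases lt_trichotomy u 0 with h | h | h
      · exact Or.inl (Or.inl ⟨hu.1, h⟩)
      · exact Or.inl (Or.inr h)
      · exact Or.inr ⟨h, hu.2⟩
    exact ((h2.union (integrableOn_singleton
      (hx := by rw [Real.volume_singleton]; exact ENNReal.zero_lt_top))).union h1).mono_set h3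
  have hmain : Integrable (fun z : ℝ × (Fin n → ℝ) => v z.2 * h (z.1 - z.2 k))
      (volume.prod μ) := by
    have hmeas : AEStronglyMeasurable (fun z : ℝ × (Fin n → ℝ) => v z.2 * h (z.1 - z.2 k))
        (volume.prod μ) := by
      refine hv.aestronglyMeasurable.comp_snd.mul ?_
      have : Measurable h := Measurable.indicator (by fun_prop) measurableSet_Ioo
      exact (by fun_prop : Measurable fun z : ℝ × (Fin n → ℝ) =>
        h (z.1 - z.2 k)).aestronglyMeasurable
    rw [integrable_prod_iff' hmeas]
    refine ⟨Filter.Eventually.of_forall fun t => (hint.comp_sub_right (t k)).const_mul (v t), ?_⟩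
    have : ∀ t : Fin n → ℝ, ∫ u, ‖v t * h (u - t k)‖ = ‖v t‖ * ∫ u, ‖h u‖ := fun t => by
      simp_rw [norm_mul]
      rw [integral_const_mul, integral_sub_right_eq_self (fun u => ‖h u‖)]
    simp only [this]
    exact hv.norm.mul_const _
  refine (hmain.mono_measure (Measure.prod_mono Measure.restrict_le_self le_rfl)).congr ?_
  have h1 : ∀ᵐ z : ℝ × (Fin n → ℝ) ∂((volume : Measure ℝ).restrict (Set.Ioo 0 1)).prod μ,
      z.1 ∈ Set.Ioo (0 : ℝ) 1 :=
    Measure.quasiMeasurePreserving_fst.ae (ae_restrict_mem measurableSet_Ioo)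
  filter_upwards [h1, Measure.quasiMeasurePreserving_snd.ae hk] with z hz1 hz2
  rw [hh, Set.indicator_of_mem]
  constructor <;> linarith [hz1.1, hz1.2, hz2.1, hz2.2]

lemma integrableOn_weight_div_sub {n : ℕ} {a b β : ℝ} (ha : -1 < a) (hb : 0 < b) (hβ : 0 < β)
    {l k : Fin (n + 1)} (hlk : l ≠ k) :
    IntegrableOn (fun t : Fin (n + 1) → ℝ =>
      weight a b β t * (t l * (1 - t l)) / (t l - t k)) (cube (n + 1)) := by
  obtain ⟨k, rfl⟩ := Fin.exists_succAbove_eq hlk.symm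
  have hdom : IntegrableOn (fun t : Fin (n + 1) → ℝ =>
      (∏ j, betaWeight a b (t (l.succAbove j))) * |t l - t (l.succAbove k)| ^ (β - 1))
      (cube (n + 1)) := by
    rw [IntegrableOn, volume_restrict_cube]
    have hv : Integrable (fun t : Fin n → ℝ => ∏ j, betaWeight a b (t j))
        (Measure.pi fun _ : Fin n => (volume : Measure ℝ).restrict (Set.Ioo 0 1)) :=
      Integrable.fintype_prod fun _ => integrableOn_betaWeight ha hb
    have hk : ∀ᵐ t ∂(Measure.pi fun _ : Fin n => (volume : Measure ℝ).restrict (Set.Ioo 0 1)),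
        t k ∈ Set.Ioo (0 : ℝ) 1 := by
      rw [← volume_restrict_cube]
      exact ae_restrict_of_forall_mem (measurableSet_cube n) fun t ht => mem_cube.1 ht k
    have hp := measurePreserving_piFinSuccAbove
      (fun _ : Fin (n + 1) => (volume : Measure ℝ).restrict (Set.Ioo 0 1)) l
    exact (hp.integrable_comp_emb (MeasurableEquiv.measurableEmbedding _)).2
      (integrable_mul_abs_sub_rpow hβ hv k hk)
  have hm := measurable_weight (N := n + 1) a b hβ.le
  refine hdom.mono' (by fun_prop : Measurable _).aestronglyMeasurable ?_
  refine ae_restrict_of_forall_mem (measurableSet_cube _) fun t ht => ?_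
  have ht' := mem_cube.1 ht
  have hP : 0 ≤ ∏ j, betaWeight a b (t (l.succAbove j)) :=
    Finset.prod_nonneg fun j _ => betaWeight_nonneg a b (ht' _)
  have hl : 0 ≤ betaWeight a b (t l) * (t l * (1 - t l)) :=
    mul_nonneg (betaWeight_nonneg a b (ht' l))
      (mul_nonneg (ht' l).1.le (sub_nonneg.2 (ht' l).2.le))
  have hr : |repulsion β t / (t l - t (l.succAbove k))| ≤
      |t l - t (l.succAbove k)| ^ (β - 1) := by
    rw [abs_div, abs_of_nonneg (repulsion_nonneg β t)]
    rcases (abs_nonneg (t l - t (l.succAbove k))).eq_or_lt with h | h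
    -- At a collision the quotient is 0 by convention, so the bound survives.
    · rw [← h, div_zero]
      exact Real.rpow_nonneg le_rfl _
    · rw [Real.rpow_sub_one h.ne']
      exact div_le_div_of_nonneg_right (repulsion_le hβ.le ht hlk) h.le
  have he : weight a b β t * (t l * (1 - t l)) / (t l - t (l.succAbove k)) =
      (betaWeight a b (t l) * (t l * (1 - t l))) * (∏ j, betaWeight a b (t (l.succAbove j))) *
        (repulsion β t / (t l - t (l.succAbove k))) := by
    rw [weight, Fin.prod_univ_succAbove _ l]
    ring
  rw [he, Real.norm_eq_abs, abs_mul, abs_of_nonneg (mul_nonneg hl hP)]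
  exact mul_le_mul (mul_le_of_le_one_left hP (betaWeight_mul_le_one ha hb (ht' l))) hr
    (abs_nonneg _) hP

/-! ### The divergence and its vanishing integral -/

/-- `t_l (1 - t_l)` times the logarithmic derivative, with respect to `t_l`, of
`t_l (1 - t_l)` times the `β`-Jacobi weight. -/
noncomputable def logDerivTerm {N : ℕ} (a b β : ℝ) (l : Fin N) (t : Fin N → ℝ) : ℝ :=
  (a + 1) * (1 - t l) - b * t l +
    ∑ k ∈ Finset.univ.erase l, β * (t l * (1 - t l)) / (t l - t k)

/-- The derivative, with respect to `t_l`, of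
`t_l (1 - t_l) w(t) e_q(1 - t_j : j ≠ l) exp (-x ∑ t_j)`. -/
noncomputable def divTerm {N : ℕ} (a b β : ℝ) (q : ℕ) (x : ℂ) (l : Fin N) (t : Fin N → ℝ) : ℂ :=
  ((weight a b β t * esymmOn (Finset.univ.erase l) q (fun j => 1 - t j) : ℝ) : ℂ) *
    ((logDerivTerm a b β l t : ℝ) - x * (t l * (1 - t l) : ℝ)) *
    Complex.exp (-x * ∑ j, (t j : ℂ))

lemma integrableOn_divTerm {n : ℕ} {a b β : ℝ} (ha : -1 < a) (hb : 0 < b) (hβ : 0 ≤ β)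
    (q : ℕ) (x : ℂ) (l : Fin (n + 1)) : IntegrableOn (divTerm a b β q x l) (cube (n + 1)) := by
  have hw := (integrable_weight (n + 1) ha hb hβ).ofReal (𝕜 := ℂ)
  have h1 := IntegrableOn.mul_continuous hw (g := fun t =>
    (((a + 1) * (1 - t l) - b * t l : ℝ) - x * (t l * (1 - t l) : ℝ))) (by fun_prop)
  have h2 : ∀ k ∈ Finset.univ.erase l, IntegrableOn (fun t : Fin (n + 1) → ℝ =>
      ((weight a b β t * (β * (t l * (1 - t l)) / (t l - t k)) : ℝ) : ℂ)) (cube (n + 1)) := by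
    intro k hk
    rcases hβ.eq_or_lt with rfl | hβ
    · simp
    · refine (((integrableOn_weight_div_sub ha hb hβ
        (Finset.ne_of_mem_erase hk).symm).const_mul β).ofReal (𝕜 := ℂ)).congr
        (Filter.Eventually.of_forall fun t => ?_)
      simp only [RCLike.ofReal_eq_complex_ofReal]
      congr 1
      ring
  have h3 := IntegrableOn.mul_continuous (h1.add (integrable_finsetSum _ h2))
    (g := fun t => (esymmOn (Finset.univ.erase l) q (fun j => 1 - t j) : ℝ) *
      Complex.exp (-x * ∑ j, (t j : ℂ))) (by fun_prop)
  refine Integrable.congr h3 (Filter.Eventually.of_forall fun t => ?_)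
  simp only [divTerm, logDerivTerm, Pi.add_apply, RCLike.ofReal_eq_complex_ofReal]
  rw [← Complex.ofReal_sum, ← Finset.mul_sum]
  push_cast
  ring

/-- The logarithmic derivatives enter as multipliers r_i rather than quotients, so factors may
vanish, as they do when two fixed coordinates coincide. -/
lemma hasDerivAt_prod_of_log {ι : Type*} {A : Finset ι} {f : ι → ℝ → ℝ} {r : ι → ℝ} {u : ℝ}
    (h : ∀ i ∈ A, HasDerivAt (f i) (f i u * r i) u) :
    HasDerivAt (fun v => ∏ i ∈ A, f i v) ((∏ i ∈ A, f i u) * ∑ i ∈ A, r i) u := by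
  classical
  refine (HasDerivAt.fun_finsetProd h).congr_deriv ?_
  rw [Finset.mul_sum]
  refine Finset.sum_congr rfl fun i hi => ?_
  rw [smul_eq_mul, ← mul_assoc, mul_comm _ (f i u), Finset.mul_prod_erase A (fun j => f j u) hi]

lemma hasDerivAt_insertNth_apply {n : ℕ} (l : Fin (n + 1)) (s : Fin n → ℝ) (j : Fin (n + 1))
    (u : ℝ) :
    HasDerivAt (fun v => l.insertNth (α := fun _ => ℝ) v s j) (if j = l then 1 else 0) u := by
  rcases Fin.eq_self_or_eq_succAbove l j with rfl | ⟨j, rfl⟩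
  · simpa using hasDerivAt_id' u
  · simpa [Fin.succAbove_ne] using hasDerivAt_const u (s j)

lemma sum_sum_Ioi_ite {N : ℕ} (l : Fin N) (t : Fin N → ℝ) (β : ℝ) :
    ∑ j : Fin N, ∑ k ∈ Finset.Ioi j,
      β * ((if k = l then 1 else 0) - (if j = l then 1 else 0)) / (t k - t j) =
    ∑ k ∈ Finset.univ.erase l, β / (t l - t k) := by
  have h1 : ∀ j k : Fin N, k ∈ Finset.Ioi j →
      β * ((if k = l then 1 else 0) - (if j = l then 1 else 0)) / (t k - t j) =
      (if k = l then β / (t l - t j) else 0) + (if j = l then β / (t l - t k) else 0) := by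
    intro j k hk
    have hjk : j < k := Finset.mem_Ioi.1 hk
    by_cases hkl : k = l
    · have hjl : j ≠ l := (hkl ▸ hjk).ne
      simp [hkl, hjl]
    · by_cases hjl : j = l
      · simp only [hkl, hjl, if_true, if_false]
        rw [← neg_sub (t l) (t k), div_neg]
        ring
      · simp [hkl, hjl]
  have h2 : ∀ j : Fin N, ∑ k ∈ Finset.Ioi j, (if k = l then β / (t l - t j) else 0) =
      if j < l then β / (t l - t j) else 0 := by
    intro j
    rw [Finset.sum_ite_eq']
    simp
  have h3 : ∀ j : Fin N, ∑ k ∈ Finset.Ioi j, (if j = l then β / (t l - t k) else 0) =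
      if j = l then ∑ k ∈ Finset.Ioi l, β / (t l - t k) else 0 := by
    intro j
    split_ifs with h
    · rw [h]
    · simp
  have h4 : (Finset.univ.erase l : Finset (Fin N)) = Finset.Iio l ∪ Finset.Ioi l := by
    ext k
    simp [lt_or_lt_iff_ne]
  rw [Finset.sum_congr rfl fun j _ => Finset.sum_congr rfl (h1 j)]
  simp only [Finset.sum_add_distrib, h2, h3]
  rw [Finset.sum_ite_eq', if_pos (Finset.mem_univ l), h4, Finset.sum_union, ← Finset.sum_filter]
  · congr 1
    refine Finset.sum_congr ?_ fun _ _ => rfl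
    ext k
    simp
  · rw [Finset.disjoint_left]
    intro k h h'
    exact lt_asymm (Finset.mem_Iio.1 h) (Finset.mem_Ioi.1 h')

lemma hasDerivAt_abs_rpow {g : ℝ → ℝ} {g' u : ℝ} (β : ℝ) (hg : HasDerivAt g g' u) (h : g u ≠ 0) :
    HasDerivAt (fun v => |g v| ^ β) (|g u| ^ β * (β * g' / g u)) u := by
  have h1 : |g u| ≠ 0 := abs_ne_zero.2 h
  refine (((hasDerivAt_abs h).comp u hg).rpow_const (Or.inl h1)).congr_deriv ?_
  simp only [Function.comp_apply]
  rw [Real.rpow_sub_one h1]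
  rcases lt_or_gt_of_ne h with h' | h'
  · simp only [abs_of_neg h', sign_neg h', SignType.coe_neg, SignType.coe_one]
    field_simp
  · simp only [abs_of_pos h', sign_pos h', SignType.coe_one]
    field_simp

lemma hasDerivAt_repulsion_insertNth {n : ℕ} (β : ℝ) (l : Fin (n + 1)) (s : Fin n → ℝ) {u : ℝ}
    (hu : u ∉ Set.range s) :
    HasDerivAt (fun v => repulsion β (l.insertNth (α := fun _ => ℝ) v s))
      (repulsion β (l.insertNth (α := fun _ => ℝ) u s) *
        ∑ k ∈ Finset.univ.erase l, β / (l.insertNth (α := fun _ => ℝ) u s l -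
          l.insertNth (α := fun _ => ℝ) u s k)) u := by
  rw [← sum_sum_Ioi_ite]
  refine hasDerivAt_prod_of_log fun j _ => hasDerivAt_prod_of_log fun k hk => ?_
  have hjk : j ≠ k := (Finset.mem_Ioi.1 hk).ne
  by_cases h : l.insertNth (α := fun _ => ℝ) u s k - l.insertNth (α := fun _ => ℝ) u s j = 0
  -- A vanishing difference cannot involve the moving coordinate, by `hu`; the factor is therefore
  -- constant.
  · rw [h, div_zero, mul_zero]
    rcases Fin.eq_self_or_eq_succAbove l k with rfl | ⟨k, rfl⟩
    · obtain ⟨j, rfl⟩ := Fin.exists_succAbove_eq hjk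
      simp only [Fin.insertNth_apply_same, Fin.insertNth_apply_succAbove] at h
      exact (hu ⟨j, (sub_eq_zero.1 h).symm⟩).elim
    · rcases Fin.eq_self_or_eq_succAbove l j with rfl | ⟨j, rfl⟩
      · simp only [Fin.insertNth_apply_same, Fin.insertNth_apply_succAbove] at h
        exact (hu ⟨k, sub_eq_zero.1 h⟩).elim
      · simpa only [Fin.insertNth_apply_succAbove] using hasDerivAt_const u _
  · exact hasDerivAt_abs_rpow β
      ((hasDerivAt_insertNth_apply l s k u).sub (hasDerivAt_insertNth_apply l s j u)) h

lemma esymmOn_erase_insertNth {n : ℕ} (l : Fin (n + 1)) (s : Fin n → ℝ) (q : ℕ) (u v : ℝ) :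
    esymmOn (Finset.univ.erase l) q (fun j => 1 - l.insertNth (α := fun _ => ℝ) u s j) =
      esymmOn (Finset.univ.erase l) q (fun j => 1 - l.insertNth (α := fun _ => ℝ) v s j) := by
  refine Finset.sum_congr rfl fun B hB => Finset.prod_congr rfl fun j hj => ?_
  obtain ⟨j, rfl⟩ := Fin.exists_succAbove_eq
    (Finset.ne_of_mem_erase ((Finset.mem_powersetCard.1 hB).1 hj))
  simp only [Fin.insertNth_apply_succAbove]

/-- `F` below is the l-th component of the field along the line: its exponents a + 1 and b make it
continuous on [0, 1] and zero at both ends. -/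
lemma integral_divTerm_insertNth {n : ℕ} {a b β : ℝ} (ha : -1 < a) (hb : 0 < b) (hβ : 0 ≤ β)
    (q : ℕ) (x : ℂ) (l : Fin (n + 1)) (s : Fin n → ℝ)
    (hint : IntegrableOn (fun u => divTerm a b β q x l (l.insertNth (α := fun _ => ℝ) u s))
      (Set.Ioo 0 1)) :
    ∫ u in Set.Ioo (0 : ℝ) 1, divTerm a b β q x l (l.insertNth (α := fun _ => ℝ) u s) = 0 := by
  set c : ℝ → Fin (n + 1) → ℝ := fun u => l.insertNth (α := fun _ => ℝ) u s with hc
  -- The symmetric polynomial omits the moving coordinate, so it may be frozen at u = 0.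
  set K : ℝ := (∏ j, betaWeight a b (s j)) *
    esymmOn (Finset.univ.erase l) q (fun j => 1 - c 0 j) with hK
  set F : ℝ → ℂ := fun u => ((u ^ (a + 1) * (1 - u) ^ b * repulsion β (c u) * K : ℝ) : ℂ) *
    Complex.exp (-x * ∑ j, (c u j : ℂ)) with hF
  have hcc : ∀ j, Continuous fun u => c u j := fun j =>
    continuous_iff_continuousAt.2 fun u => (hasDerivAt_insertNth_apply l s j u).continuousAt
  have hcont : ContinuousOn F (Set.Icc 0 1) := by
    have h1 : Continuous fun u : ℝ => u ^ (a + 1) :=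
      Real.continuous_rpow_const (by linarith)
    have h2 : Continuous fun u : ℝ => (1 - u) ^ b :=
      (Real.continuous_rpow_const hb.le).comp (by fun_prop)
    have h3 : Continuous fun u => repulsion β (c u) :=
      (continuous_repulsion hβ).comp (continuous_pi hcc)
    have h4 : Continuous fun u => ∑ j, (c u j : ℂ) :=
      continuous_finsetSum _ fun j _ => Complex.continuous_ofReal.comp (hcc j)
    exact Continuous.continuousOn (by fun_prop)
  have hderiv : ∀ u ∈ Set.Ioo (0 : ℝ) 1 \ Set.range s,
      HasDerivAt F (divTerm a b β q x l (c u)) u := by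
    rintro u ⟨hu, hus⟩
    have hu0 : u ≠ 0 := hu.1.ne'
    have hu1 : 1 - u ≠ 0 := (sub_pos.2 hu.2).ne'
    have h1 := (Real.hasDerivAt_rpow_const (p := a + 1) (Or.inl hu0)).fun_mul
      (((hasDerivAt_id u).const_sub 1).rpow_const (p := b) (Or.inl hu1))
    have h2 := ((h1.fun_mul (hasDerivAt_repulsion_insertNth β l s hus)).mul_const K).ofReal_comp
    have h3 : HasDerivAt (fun v => ∑ j, (c v j : ℂ)) 1 u := by
      refine (HasDerivAt.fun_sum fun j _ =>
        (hasDerivAt_insertNth_apply l s j u).ofReal_comp).congr_deriv ?_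
      rw [← Complex.ofReal_sum]
      simp
    refine (h2.fun_mul ((h3.const_mul (-x)).cexp)).congr_deriv ?_
    have hcl : c u l = u := by simp [hc]
    have hw : weight a b β (c u) = u ^ a * (1 - u) ^ (b - 1) * (∏ j, betaWeight a b (s j)) *
        repulsion β (c u) := by
      rw [weight, Fin.prod_univ_succAbove _ l, hcl]
      simp only [hc, Fin.insertNth_apply_succAbove, betaWeight]
    have hsum : ∑ k ∈ Finset.univ.erase l, β * (u * (1 - u)) / (u - c u k) =
        u * (1 - u) * ∑ k ∈ Finset.univ.erase l, β / (u - c u k) := by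
      rw [Finset.mul_sum]
      exact Finset.sum_congr rfl fun k _ => by ring
    have hae : u ^ (a + 1) = u ^ a * u := Real.rpow_add_one hu0 a
    have hbe : (1 - u) ^ b = (1 - u) ^ (b - 1) * (1 - u) := by
      rw [Real.rpow_sub_one hu1, div_mul_cancel₀ _ hu1]
    have hae' : u ^ (a + 1 - 1) = u ^ a := by rw [add_sub_cancel_right]
    change _ = divTerm a b β q x l (c u)
    simp only [divTerm, logDerivTerm, hcl, hsum, hw, id]
    simp only [esymmOn_erase_insertNth l s q u 0, hK, hc, hae, hae', hbe, Fin.insertNth_apply_same]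
    push_cast
    ring
  have hzero : F 0 = 0 := by simp [hF, Real.zero_rpow (by linarith : a + 1 ≠ 0)]
  have hone : F 1 = 0 := by simp [hF, Real.zero_rpow hb.ne']
  have := integral_eq_of_hasDerivAt_off_countable_of_le F _ zero_le_one
    (Set.finite_range s).countable hcont hderiv
    ((intervalIntegrable_iff_integrableOn_Ioo_of_le zero_le_one).2 hint)
  rwa [intervalIntegral.integral_of_le zero_le_one, integral_Ioc_eq_integral_Ioo, hzero, hone,
    sub_zero] at this

lemma integral_divTerm {n : ℕ} {a b β : ℝ} (ha : -1 < a) (hb : 0 < b) (hβ : 0 ≤ β)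
    (q : ℕ) (x : ℂ) (l : Fin (n + 1)) :
    ∫ t in cube (n + 1), divTerm a b β q x l t = 0 := by
  have hint := integrableOn_divTerm ha hb hβ q x l
  have hp := (measurePreserving_piFinSuccAbove
    (fun _ : Fin (n + 1) => (volume : Measure ℝ).restrict (Set.Ioo 0 1)) l).symm
  rw [IntegrableOn, volume_restrict_cube,
    ← hp.integrable_comp_emb (MeasurableEquiv.measurableEmbedding _)] at hint
  rw [volume_restrict_cube, ← hp.integral_comp']
  refine (integral_prod_symm _ hint).trans ?_
  refine integral_eq_zero_of_ae ?_
  filter_upwards [hint.prod_left_ae] with s hs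
  exact integral_divTerm_insertNth ha hb hβ q x l s hs

/-! ### Summing the divergence; recurrences for the integrals -/

/-- Everything is rewritten in s = 1 - t. The term -∑ t_l, which represents d/dx, arises from (∑
s_l) e_{q+1} through `sum_mul_esymmOn`. -/
lemma sum_divTerm {N : ℕ} (a b β : ℝ) (q : ℕ) (x : ℂ) (t : Fin N → ℝ) :
    ∑ l, divTerm a b β q x l t =
      Btilde N a b β (q + 1) * integrand N a b β (q + 1) x t
        - (N - q) * (b + β / 2 * (N - q - 1)) * integrand N a b β q x t
        + x * (N - (q + 1)) * integrand N a b β (q + 1) x t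
        + x * (integrand N a b β (q + 1) x t * -∑ l, (t l : ℂ))
        - x * ((q + 2) * integrand N a b β (q + 2) x t) := by
  set s : Fin N → ℝ := fun l => 1 - t l with hs
  set e : ℕ → ℝ := fun p => esymmOn Finset.univ p s with he
  have hT : ∑ l, t l = N - ∑ l, s l := by simp [hs]
  have h1 : ∑ l, s l * esymmOn (Finset.univ.erase l) q s = (q + 1) * e (q + 1) :=
    sum_mul_esymmOn_erase s _ q
  have h2 : ∑ l, esymmOn (Finset.univ.erase l) q s = (N - q) * e q := by
    simpa using sum_esymmOn_erase s Finset.univ q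
  have h3 : (∑ l, s l) * e (q + 1) =
      (q + 2) * e (q + 2) + ∑ l, s l ^ 2 * esymmOn (Finset.univ.erase l) q s :=
    sum_mul_esymmOn s _ q
  have h4 : weight a b β t * ∑ l, ∑ k ∈ Finset.univ.erase l,
      β * (t l * (1 - t l)) / (t l - t k) * esymmOn (Finset.univ.erase l) q s =
      weight a b β t * (β / 2 * ((q + 1) * (2 * N - q - 2) * e (q + 1)
        - (N - q - 1) * (N - q) * e q)) := by
    -- The pole cancellation needs distinct coordinates. Otherwise both sides vanish: through the
    -- factor β if β = 0, through the weight if β ≠ 0 and coordinates coincide.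
    rcases eq_or_ne β 0 with rfl | hβ
    · simp
    by_cases hinj : Function.Injective t
    · have h := sum_esymmOn_div_sub s Finset.univ
        (fun i _ j _ h => hinj (sub_right_injective h)) q
      rw [Finset.card_univ, Fintype.card_fin] at h
      rw [← h]
      congr 1
      simp only [Finset.mul_sum]
      refine Finset.sum_congr rfl fun l _ => Finset.sum_congr rfl fun k _ => ?_
      rw [show s k - s l = t l - t k by simp [hs], show t l = 1 - s l by simp [hs]]
      ring
    · simp [weight, repulsion_eq_zero hβ hinj]
  have hreal : weight a b β t * ∑ l, esymmOn (Finset.univ.erase l) q s * logDerivTerm a b β l t =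
      weight a b β t * (Btilde N a b β (q + 1) * e (q + 1)
        - (N - q) * (b + β / 2 * (N - q - 1)) * e q) := by
    have : ∑ l, esymmOn (Finset.univ.erase l) q s * logDerivTerm a b β l t =
        (a + 1 + b) * ∑ l, s l * esymmOn (Finset.univ.erase l) q s
          - b * ∑ l, esymmOn (Finset.univ.erase l) q s
          + ∑ l, ∑ k ∈ Finset.univ.erase l,
            β * (t l * (1 - t l)) / (t l - t k) * esymmOn (Finset.univ.erase l) q s := by
      rw [Finset.mul_sum, Finset.mul_sum, ← Finset.sum_sub_distrib, ← Finset.sum_add_distrib]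
      refine Finset.sum_congr rfl fun l _ => ?_
      rw [← Finset.sum_mul, logDerivTerm]
      simp only [hs]
      ring
    rw [this, mul_add, h4, h1, h2, Btilde]
    push_cast
    ring
  have hx : ∑ l, esymmOn (Finset.univ.erase l) q s * (t l * (1 - t l)) =
      -((N - (q + 1)) * e (q + 1)) + (∑ l, t l) * e (q + 1) + (q + 2) * e (q + 2) := by
    have : ∑ l, esymmOn (Finset.univ.erase l) q s * (t l * (1 - t l)) =
        ∑ l, s l * esymmOn (Finset.univ.erase l) q s
          - ∑ l, s l ^ 2 * esymmOn (Finset.univ.erase l) q s := by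
      rw [← Finset.sum_sub_distrib]
      refine Finset.sum_congr rfl fun l _ => ?_
      simp only [hs]
      ring
    rw [this, h1, hT]
    linear_combination h3
  have hsplit : ∑ l, divTerm a b β q x l t =
      (((weight a b β t * ∑ l, esymmOn (Finset.univ.erase l) q s * logDerivTerm a b β l t : ℝ) : ℂ)
        - x * ((weight a b β t * ∑ l, esymmOn (Finset.univ.erase l) q s * (t l * (1 - t l)) : ℝ) :
          ℂ)) * Complex.exp (-x * ∑ j, (t j : ℂ)) := by
    push_cast
    rw [Finset.mul_sum, Finset.mul_sum, Finset.mul_sum, ← Finset.sum_sub_distrib, Finset.sum_mul]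
    refine Finset.sum_congr rfl fun l _ => ?_
    simp only [divTerm]
    push_cast
    ring
  rw [hsplit, hreal, hx]
  simp only [integrand_eq]
  change _ = (Btilde N a b β (q + 1) : ℂ) * (((weight a b β t * e (q + 1) : ℝ) : ℂ) * _)
    - _ * (((weight a b β t * e q : ℝ) : ℂ) * _)
    + _ * (((weight a b β t * e (q + 1) : ℝ) : ℂ) * _)
    + _ * ((((weight a b β t * e (q + 1) : ℝ) : ℂ) * _) * _)
    - _ * (_ * (((weight a b β t * e (q + 2) : ℝ) : ℂ) * _))
  push_cast
  ring

lemma integrand_zero_add_mul_sum (N : ℕ) (a b β : ℝ) (x : ℂ) (t : Fin N → ℝ) :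
    N * integrand N a b β 0 x t + integrand N a b β 0 x t * -∑ l, (t l : ℂ) =
      integrand N a b β 1 x t := by
  have h : ((∑ l, (1 - t l) : ℝ) : ℂ) = N - ∑ l, (t l : ℂ) := by simp
  simp only [integrand_eq, esymmOn_zero, esymmOn_one, Complex.ofReal_mul, h, Complex.ofReal_one]
  ring

lemma integral_integrand_one (N : ℕ) {a b β : ℝ} (ha : -1 < a) (hb : 0 < b) (hβ : 0 ≤ β) (x : ℂ) :
    ∫ t in cube N, integrand N a b β 1 x t =
      N * (∫ t in cube N, integrand N a b β 0 x t) +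
        ∫ t in cube N, integrand N a b β 0 x t * -∑ l, (t l : ℂ) := by
  have h0 := integrableOn_integrand N ha hb hβ 0 x
  rw [← integral_const_mul, ← integral_add (h0.const_mul _)
    (IntegrableOn.mul_continuous h0 (g := fun t => -∑ l, (t l : ℂ)) (by fun_prop))]
  simp only [integrand_zero_add_mul_sum]

lemma integral_integrand_rec (N : ℕ) {a b β : ℝ} (ha : -1 < a) (hb : 0 < b) (hβ : 0 ≤ β) (q : ℕ)
    (x : ℂ) :
    Btilde N a b β (q + 1) * (∫ t in cube N, integrand N a b β (q + 1) x t)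
      - (N - q) * (b + β / 2 * (N - q - 1)) * (∫ t in cube N, integrand N a b β q x t)
      + x * (N - (q + 1)) * (∫ t in cube N, integrand N a b β (q + 1) x t)
      + x * (∫ t in cube N, integrand N a b β (q + 1) x t * -∑ l, (t l : ℂ))
      - x * ((q + 2) * ∫ t in cube N, integrand N a b β (q + 2) x t) = 0 := by
  have hI := fun p => integrableOn_integrand N ha hb hβ p x
  have hD := IntegrableOn.mul_continuous (hI (q + 1)) (g := fun t => -∑ l, (t l : ℂ)) (by fun_prop)
  have hsum : ∫ t in cube N, ∑ l, divTerm a b β q x l t = 0 := by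
    cases N with
    | zero => simp
    | succ n =>
      rw [integral_finsetSum _ fun l _ => integrableOn_divTerm ha hb hβ q x l]
      exact Finset.sum_eq_zero fun l _ => integral_divTerm ha hb hβ q x l
  simp only [sum_divTerm] at hsum
  rw [integral_sub, integral_add, integral_add, integral_sub] at hsum
  · simpa only [integral_const_mul] using hsum
  · exact (hI _).const_mul _
  · exact (hI _).const_mul _
  · exact ((hI _).const_mul _).sub ((hI _).const_mul _)
  · exact (hI _).const_mul _
  · exact (((hI _).const_mul _).sub ((hI _).const_mul _)).add ((hI _).const_mul _)
  · exact hD.const_mul _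
  · exact ((((hI _).const_mul _).sub ((hI _).const_mul _)).add ((hI _).const_mul _)).add
      (hD.const_mul _)
  · exact ((hI _).const_mul _).const_mul _

/-! ### Normalisation and the differential-difference system -/

lemma hasDerivAt_Hhat (N : ℕ) {a b β : ℝ} (ha : -1 < a) (hb : 0 < b) (hβ : 0 ≤ β) (p : ℕ) (x : ℂ) :
    HasDerivAt (Hhat N a b β p)
      (1 / (N.choose p : ℂ) * ∫ t in cube N, integrand N a b β p x t * -∑ l, (t l : ℂ)) x :=
  (hasDerivAt_integral_integrand N ha hb hβ p x).const_mul _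

/-- This is (p + 1) C(N, p + 1) = (N - p) C(N, p). Keeping N - p on the left includes p = N, where
the binomial C(N, N + 1) is 0 but e_{N+1} vanishes too. -/
lemma sub_mul_Hhat_succ {N p : ℕ} (a b β : ℝ) (hp : p ≤ N) (x : ℂ) :
    ((N : ℂ) - p) * Hhat N a b β (p + 1) x =
      1 / (N.choose p : ℂ) * ((p + 1) * ∫ t in cube N, integrand N a b β (p + 1) x t) := by
  rcases hp.eq_or_lt with rfl | hlt
  · have : ∀ t : Fin p → ℝ, integrand p a b β (p + 1) x t = 0 := fun t => by
      rw [integrand_eq, esymmOn, Finset.powersetCard_eq_empty.2 (by simp)]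
      simp
    simp [this]
  · have h := Nat.choose_succ_right_eq N p
    have h1 : (N.choose p : ℂ) ≠ 0 := Nat.cast_ne_zero.2 (Nat.choose_pos hp).ne'
    have h2 : (N.choose (p + 1) : ℂ) ≠ 0 := Nat.cast_ne_zero.2 (Nat.choose_pos hlt).ne'
    have h3 : (N.choose (p + 1) : ℂ) * (p + 1) = N.choose p * (N - p) := by
      rw [← Nat.cast_sub hp]
      exact_mod_cast h
    rw [Hhat]
    field_simp
    linear_combination -(∫ t in cube N, integrand N a b β (p + 1) x t) * h3

lemma mul_Hhat {N q : ℕ} (a b β : ℝ) (hq : q + 1 ≤ N) (x : ℂ) :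
    ((q : ℂ) + 1) * Hhat N a b β q x =
      1 / (N.choose (q + 1) : ℂ) * ((N - q) * ∫ t in cube N, integrand N a b β q x t) := by
  have h := Nat.choose_succ_right_eq N q
  have hq' : q ≤ N := by omega
  have h1 : (N.choose q : ℂ) ≠ 0 := Nat.cast_ne_zero.2 (Nat.choose_pos hq').ne'
  have h2 : (N.choose (q + 1) : ℂ) ≠ 0 := Nat.cast_ne_zero.2 (Nat.choose_pos hq).ne'
  have h3 : (N.choose (q + 1) : ℂ) * (q + 1) = N.choose q * (N - q) := by
    rw [← Nat.cast_sub hq']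
    exact_mod_cast h
  rw [Hhat]
  field_simp
  linear_combination (∫ t in cube N, integrand N a b β q x t) * h3

lemma systemAt_Hhat (N : ℕ) {a b β : ℝ} (ha : -1 < a) (hb : 0 < b) (hβ : 0 ≤ β) (x : ℂ) :
    SystemAt N a b β (Hhat N a b β) x := by
  intro p hp
  rw [(hasDerivAt_Hhat N ha hb hβ p x).deriv, mul_right_comm, sub_mul_Hhat_succ a b β hp x]
  cases p with
  | zero =>
    rw [zero_add, integral_integrand_one N ha hb hβ x, Hhat]
    simp [Btilde, Dtilde]
    ring
  | succ q =>
    have h1 := integral_integrand_rec N ha hb hβ q x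
    have h2 := mul_Hhat a b β hp x
    have hD : (Dtilde N b β (q + 1 : ℕ) : ℂ) * Hhat N a b β (q + 1 - 1) x =
        (b + β / 2 * (N - q - 1)) * (((q : ℂ) + 1) * Hhat N a b β q x) := by
      rw [Nat.add_sub_cancel, Dtilde]
      push_cast
      ring
    rw [hD, h2, Hhat]
    push_cast at h1 ⊢
    linear_combination -(1 / (N.choose (q + 1) : ℂ)) * h1

/-! ### Matrix form -/

lemma mulVec_vec_apply (N : ℕ) (a b β : ℝ) (G : ℕ → ℂ → ℂ) (x : ℂ) (p : Fin (N + 1)) :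
    (x • X N + Y N a b β).mulVec (vec N G x) p =
      -(((N : ℂ) - (p : ℕ)) * x + Btilde N a b β p) * G p x
        + ((N : ℂ) - (p : ℕ)) * x * G (p + 1) x + Dtilde N b β p * G (p - 1) x := by
  obtain ⟨p, hp⟩ := p
  have hterm : ∀ j : ℕ,
      (x * (if j = p then -((N : ℂ) - p) else if j = p + 1 then (N : ℂ) - p else 0) +
        (if j = p then -(Btilde N a b β p : ℂ) else if p = j + 1 then (Dtilde N b β p : ℂ) else 0)) *
          G j x =
      (if j = p then -(((N : ℂ) - p) * x + Btilde N a b β p) * G p x else 0) +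
      (if j = p + 1 then ((N : ℂ) - p) * x * G (p + 1) x else 0) +
      (if p = j + 1 then Dtilde N b β p * G (p - 1) x else 0) := by
    intro j
    rcases lt_trichotomy j p with h | h | h
    · by_cases h' : p = j + 1
      · subst h'
        simp [show j ≠ j + 1 + 1 by omega]
      · simp [h.ne, h', show j ≠ p + 1 by omega]
    · subst h
      simp only [if_true, (Nat.succ_ne_self j).symm, if_false]
      ring
    · by_cases h' : j = p + 1
      · subst h'
        simp [show p ≠ p + 1 + 1 by omega, mul_comm]
      · simp [h.ne', h', show p ≠ j + 1 by omega]
  have hsum : (x • X N + Y N a b β).mulVec (vec N G x) ⟨p, hp⟩ =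
      ∑ j ∈ Finset.range (N + 1), ((if j = p then -(((N : ℂ) - p) * x + Btilde N a b β p) * G p x
          else 0) +
        (if j = p + 1 then ((N : ℂ) - p) * x * G (p + 1) x else 0) +
        (if p = j + 1 then Dtilde N b β p * G (p - 1) x else 0)) := by
    rw [← Fin.sum_univ_eq_sum_range (fun j =>
        (if j = p then -(((N : ℂ) - p) * x + Btilde N a b β p) * G p x else 0) +
          (if j = p + 1 then ((N : ℂ) - p) * x * G (p + 1) x else 0) +
          (if p = j + 1 then (Dtilde N b β p : ℂ) * G (p - 1) x else 0)), Matrix.mulVec, dotProduct]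
    refine Finset.sum_congr rfl fun j _ => ?_
    rw [← hterm]
    simp [X, Y, vec]
  rw [hsum, Finset.sum_add_distrib, Finset.sum_add_distrib, Finset.sum_ite_eq',
    Finset.sum_ite_eq', if_pos (Finset.mem_range.2 hp)]
  congr 1
  · congr 1
    split_ifs with h
    · rfl
    -- The superdiagonal leaves the matrix only at p = N, where N - p = 0.
    · rw [Finset.mem_range] at h
      have : p = N := by omega
      simp [this]
  · cases p with
    | zero => simp [Dtilde]
    | succ p =>
      simp only [Nat.add_right_cancel_iff]
      rw [Finset.sum_ite_eq, if_pos (Finset.mem_range.2 (by omega))]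

lemma systemAt_iff_matrixEqAt (N : ℕ) (a b β : ℝ) (G : ℕ → ℂ → ℂ) (x : ℂ)
    (hG : ∀ p : ℕ, p ≤ N → DifferentiableAt ℂ (G p) x) :
    SystemAt N a b β G x ↔ MatrixEqAt N a b β G x := by
  have hd : deriv (vec N G) x = fun p : Fin (N + 1) => deriv (G p) x :=
    deriv_pi fun p => hG p (Nat.lt_succ_iff.1 p.2)
  rw [MatrixEqAt, hd, funext_iff, SystemAt]
  constructor
  · intro h p
    rw [mulVec_vec_apply, Pi.smul_apply, smul_eq_mul]
    linear_combination -h p (Nat.lt_succ_iff.1 p.2)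
  · intro h p hp
    have := h ⟨p, Nat.lt_succ_iff.2 hp⟩
    rw [mulVec_vec_apply, Pi.smul_apply, smul_eq_mul] at this
    linear_combination -this

end JacobiTrace

theorem corollary2p5 (N : ℕ) (a b β : ℝ) (ha : -1 < a) (hb : 0 < b) (hβ : 0 ≤ β) :
    (∀ p : ℕ, p ≤ N →
      (∀ x : ℂ, IntegrableOn (JacobiTrace.integrand N a b β p x) (JacobiTrace.cube N)) ∧
      Differentiable ℂ (JacobiTrace.Hhat N a b β p)) ∧
    (∀ x : ℂ, JacobiTrace.SystemAt N a b β (JacobiTrace.Hhat N a b β) x) ∧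
    (∀ x : ℂ, JacobiTrace.MatrixEqAt N a b β (JacobiTrace.Hhat N a b β) x) ∧
    (∀ (G : ℕ → ℂ → ℂ) (x : ℂ), (∀ p : ℕ, p ≤ N → DifferentiableAt ℂ (G p) x) →
      (JacobiTrace.SystemAt N a b β G x ↔ JacobiTrace.MatrixEqAt N a b β G x)) := by
  refine ⟨fun p _ => ⟨JacobiTrace.integrableOn_integrand N ha hb hβ p, fun x =>
    (JacobiTrace.hasDerivAt_Hhat N ha hb hβ p x).differentiableAt⟩,
    JacobiTrace.systemAt_Hhat N ha hb hβ, fun x => ?_,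
    JacobiTrace.systemAt_iff_matrixEqAt N a b β⟩
  exact (JacobiTrace.systemAt_iff_matrixEqAt N a b β _ x fun p _ =>
    (JacobiTrace.hasDerivAt_Hhat N ha hb hβ p x).differentiableAt).1
    (JacobiTrace.systemAt_Hhat N ha hb hβ x)
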